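/- \textbf{Model.} A source evolves as an irreducible continuous-time Markov chain $Q(t)$ on $\{1,\dots,M\}$ with generator $(q_{ij})$ and stationary distribution $\pi$; write $\nu_m=\sum_{r\ne m}q_{mr}$. There are $n\ge 1$ nodes. The source holds a version number $V_0(t)$, which increases by $1$ at every state transition of the source; node $i$ holds a packet with version $V_i(t)$ and content $S_i(t)\in\{1,\dots,M\}$. At the times of independent Poisson clocks, also independent of the source: with rate $\lambda_s/n$ for each node $j$, the source pushes to $j$, which sets $V_j=V_0$, $S_j=Q$; with rate $\lambda/(n-1)$ for each ordered pair $i\neq j$, node $i$ sends its packet to $j$, which sets $(V_j,S_j)=(V_i,S_i)$ if $V_i>V_j$ and changes nothing otherwise. For a set $A_k$ of $k$ nodes let $X_{A_k}(t)=\min_{j\in A_k}(V_0(t)-V_j(t))$ and $C_{A_k}(t)=\frac1k\#\{j\in A_k: S_j(t)=Q(t)\}$, and put $$c_k^{(m)}=\lim_{t\to\infty}\mathbb E\big[C_{A_k}(t)\mathbf 1_{\{Q(t)=m\}}\big],\qquad g_k^{(m)}=\lim_{t\to\infty}\mathbb P\big(Q(t)=m,\,X_{A_k}(t)=0\big),\qquad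 G_k=\sum_{m=1}^M c_k^{(m)}g_k^{(m)},\qquad \alpha_k=\frac{k\lambda_s}{n}.$$ \textbf{Corollary (no gossip).} Fix $\lambda_s>0$ and $k\in\{1,\dots,n\}$. For every $\lambda\ge 0$ and $m\in\{1,\dots,M\}$ the limits $c_k^{(m)}=c_k^{(m)}(\lambda)$ and $g_k^{(m)}=g_k^{(m)}(\lambda)$ exist and depend neither on the initial configuration nor on the choice of the $k$-node set $A_k$. For every $m$, $$\lim_{\lambda\to0^+}g_k^{(m)}(\lambda)=g_k^{(m)}(0)=\frac{\alpha_k\pi_m}{\nu_m+\alpha_k},$$ where $g_k^{(m)}(0)$ is the long-run probability $\mathbb P(Q=m,X_{A_k}=0)$ in the network without gossip. Consequently, the limits $\lim_{\lambda\to0^+}c_k^{(m)}(\lambda)$ exist and $$\lim_{\lambda\to0^+}G_k(\lambda)=\sum_{m=1}^M\frac{\alpha_k\pi_m}{\nu_m+\alpha_k}\,\lim_{\lambda\to0^+}c_k^{(m)}(\lambda).$$ -/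

import Mathlib

open MeasureTheory ProbabilityTheory Filter Topology

namespace GossipNetwork

/-- `q` is the generator matrix of an irreducible continuous-time Markov chain on `Fin M`:
nonnegative off-diagonal rates, rows summing to zero, and any state can be reached from any other
one through transitions of positive rate. -/
structure IsIrreducibleGenerator {M : ℕ} (q : Matrix (Fin M) (Fin M) ℝ) : Prop where
  nonneg : ∀ i j, i ≠ j → 0 ≤ q i j
  row_sum : ∀ i, ∑ j, q i j = 0
  irreducible : ∀ i j, Relation.ReflTransGen (fun a b => a ≠ b ∧ 0 < q a b) i j

/-- `p` is a stationary distribution of the chain with generator `q`. -/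
structure IsStationaryDistribution {M : ℕ} (q : Matrix (Fin M) (Fin M) ℝ) (p : Fin M → ℝ) :
    Prop where
  nonneg : ∀ i, 0 ≤ p i
  sum_eq_one : ∑ i, p i = 1
  balance : ∀ j, ∑ i, p i * q i j = 0

/-- The events of the network: a source transition `i → j` (effective only when the source is in
state `i`), a push from the source to node `j`, a gossip message from node `i` to node `j`. -/
inductive Event (M n : ℕ) : Type
  | source (i j : Fin M)
  | push (j : Fin n)
  | gossip (i j : Fin n)
  deriving DecidableEq, Fintype

instance (M n : ℕ) : MeasurableSpace (Event M n) := ⊤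

/-- The configuration of the network: the state `Q` of the source, the version `V₀` at the source,
and the version `V i` and the content `S i` of the packet held by each node `i`. -/
@[ext] structure Config (M n : ℕ) : Type where
  Q : Fin M
  V₀ : ℕ
  V : Fin n → ℕ
  S : Fin n → Fin M

/-- The effect of an event on a configuration. -/
def Config.next {M n : ℕ} (z : Config M n) : Event M n → Config M n
  | .source i j => if z.Q = i then { z with Q := j, V₀ := z.V₀ + 1 } else z
  | .push j => { z with V := Function.update z.V j z.V₀, S := Function.update z.S j z.Q }
  | .gossip i j =>
      if z.V j < z.V i then
        { z with V := Function.update z.V j (z.V i), S := Function.update z.S j (z.S i) }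
      else z

/-- The version age `X_i = V₀ - V_i` of node `i`. -/
def Config.age {M n : ℕ} (z : Config M n) (i : Fin n) : ℤ := (z.V₀ : ℤ) - (z.V i : ℤ)

/-- The version age of a nonempty set of nodes: the least version age in the set. -/
def Config.setAge {M n : ℕ} (z : Config M n) (A : Finset (Fin n)) (hA : A.Nonempty) : ℤ :=
  A.inf' hA z.age

/-- The average accuracy of a set of nodes: the fraction of its nodes whose content is the current
state of the source. -/
noncomputable def Config.accuracy {M n : ℕ} (z : Config M n) (A : Finset (Fin n)) : ℝ :=
  (∑ i ∈ A, if z.S i = z.Q then (1 : ℝ) else 0) / (A.card : ℝ)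

/-- The rate of the independent Poisson clock of each event: `q i j` for a source transition,
`lamS / n` for a push, `lam / (n - 1)` for a gossip message from a node to another one. -/
noncomputable def rate {M n : ℕ} (q : Matrix (Fin M) (Fin M) ℝ) (lamS lam : ℝ) :
    Event M n → ℝ
  | .source i j => if i = j then 0 else q i j
  | .push _ => lamS / (n : ℝ)
  | .gossip i j => if i = j then 0 else lam / ((n : ℝ) - 1)

/-- The rate of the superposition of all clocks. -/
noncomputable def totalRate {M : ℕ} (n : ℕ) (q : Matrix (Fin M) (Fin M) ℝ) (lamS lam : ℝ) : ℝ :=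
  ∑ e : Event M n, rate q lamS lam e

/-- When a clock rings, it is the clock of `e` with probability `rate e / totalRate`. -/
noncomputable def eventLaw {M : ℕ} (n : ℕ) (q : Matrix (Fin M) (Fin M) ℝ) (lamS lam : ℝ) :
    Measure (Event M n) :=
  ∑ e : Event M n, ENNReal.ofReal (rate q lamS lam e / totalRate n q lamS lam) • Measure.dirac e

/-- A sample point: the waiting times between successive rings, and the successive events. -/
abbrev Sample (M n : ℕ) : Type := (ℕ → ℝ) × (ℕ → Event M n)

/-- The superposition of the independent Poisson clocks: independent exponential waiting times whose
parameter is the total rate and, independently of them, independent events with law `eventLaw`. -/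
noncomputable def clockLaw {M : ℕ} (n : ℕ) (q : Matrix (Fin M) (Fin M) ℝ) (lamS lam : ℝ) :
    Measure (Sample M n) :=
  (Measure.infinitePi fun _ : ℕ => expMeasure (totalRate n q lamS lam)).prod
    (Measure.infinitePi fun _ : ℕ => eventLaw n q lamS lam)

theorem rate_nonneg {M n : ℕ} {q : Matrix (Fin M) (Fin M) ℝ} (hq : IsIrreducibleGenerator q)
    {lamS lam : ℝ} (hlamS : 0 < lamS) (hlam : 0 ≤ lam) (e : Event M n) :
    0 ≤ rate q lamS lam e := by
  cases e with
  | source i j =>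
    by_cases h : i = j
    · simp [rate, h]
    · simpa [rate, h] using hq.nonneg i j h
  | push j => simp only [rate]; positivity
  | gossip i j =>
    by_cases h : i = j
    · simp [rate, h]
    · have hn : (1 : ℝ) ≤ (n : ℝ) := by
        exact_mod_cast (Nat.succ_le_of_lt (lt_of_le_of_lt (Nat.zero_le _) i.isLt))
      simp only [rate, h, if_false]
      exact div_nonneg hlam (by linarith)

theorem totalRate_pos {M n : ℕ} {q : Matrix (Fin M) (Fin M) ℝ} (hq : IsIrreducibleGenerator q)
    {lamS lam : ℝ} (hlamS : 0 < lamS) (hlam : 0 ≤ lam) (hn : 1 ≤ n) :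
    0 < totalRate n q lamS lam := by
  have hn' : (0 : ℝ) < (n : ℝ) := by exact_mod_cast hn
  refine Finset.sum_pos' (fun e _ => rate_nonneg hq hlamS hlam e)
    ⟨Event.push ⟨0, hn⟩, Finset.mem_univ _, ?_⟩
  simp only [rate]
  positivity

theorem isProbabilityMeasure_eventLaw {M n : ℕ} {q : Matrix (Fin M) (Fin M) ℝ}
    (hq : IsIrreducibleGenerator q) {lamS lam : ℝ} (hlamS : 0 < lamS) (hlam : 0 ≤ lam)
    (hn : 1 ≤ n) : IsProbabilityMeasure (eventLaw n q lamS lam) := by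
  have hpos := totalRate_pos (n := n) hq hlamS hlam hn
  constructor
  simp only [eventLaw, Measure.finsetSum_apply, Measure.smul_apply, measure_univ, smul_eq_mul,
    mul_one]
  rw [← ENNReal.ofReal_sum_of_nonneg
    (fun e _ => div_nonneg (rate_nonneg hq hlamS hlam e) hpos.le), ← Finset.sum_div]
  rw [show (∑ e : Event M n, rate q lamS lam e) = totalRate n q lamS lam from rfl,
    div_self hpos.ne', ENNReal.ofReal_one]

theorem isProbabilityMeasure_clockLaw {M n : ℕ} {q : Matrix (Fin M) (Fin M) ℝ}
    (hq : IsIrreducibleGenerator q) {lamS lam : ℝ} (hlamS : 0 < lamS) (hlam : 0 ≤ lam)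
    (hn : 1 ≤ n) : IsProbabilityMeasure (clockLaw n q lamS lam) := by
  have := isProbabilityMeasure_eventLaw (n := n) hq hlamS hlam hn
  have := isProbabilityMeasure_expMeasure (totalRate_pos (n := n) hq hlamS hlam hn)
  unfold clockLaw
  infer_instance

/-- The number of rings in the time interval `[0, t]`: the least `N` such that ring number `N + 1`
comes after time `t`. -/
noncomputable def ringCount (τ : ℕ → ℝ) (t : ℝ) : ℕ :=
  sInf {N : ℕ | t < ∑ i ∈ Finset.range (N + 1), τ i}

/-- The configuration after the first `N` events, started from `z₀`. -/
def configAfter {M n : ℕ} (z₀ : Config M n) (ev : ℕ → Event M n) : ℕ → Config M n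
  | 0 => z₀
  | N + 1 => (configAfter z₀ ev N).next (ev N)

/-- The network process: the configuration at time `t`, started from `z₀`. Under `clockLaw` it is
the Markov jump process in which each event `e` happens at rate `rate e`. -/
noncomputable def process {M n : ℕ} (z₀ : Config M n) (t : ℝ) (ω : Sample M n) : Config M n :=
  configAfter z₀ ω.2 (ringCount ω.1 t)

/-- `E[C_A(t) 1{Q(t) = m}]`, the expected average accuracy of `A` at time `t` on `Q(t) = m`. -/
noncomputable def expAccuracy {M n : ℕ} (q : Matrix (Fin M) (Fin M) ℝ) (lamS lam : ℝ)
    (z₀ : Config M n) (A : Finset (Fin n)) (m : Fin M) (t : ℝ) : ℝ :=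
  ∫ ω, (if (process z₀ t ω).Q = m then (process z₀ t ω).accuracy A else 0)
    ∂(clockLaw n q lamS lam)

/-- `P(Q(t) = m, X_A(t) = 0)`. -/
noncomputable def probFresh {M n : ℕ} (q : Matrix (Fin M) (Fin M) ℝ) (lamS lam : ℝ)
    (z₀ : Config M n) (A : Finset (Fin n)) (hA : A.Nonempty) (m : Fin M) (t : ℝ) : ℝ :=
  (clockLaw n q lamS lam).real
    {ω | (process z₀ t ω).Q = m ∧ (process z₀ t ω).setAge A hA = 0}

/-- The rate `α_k = k λ_s / n` of pushes from the source to a set of `k` nodes. -/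
noncomputable def pushRate (n : ℕ) (lamS : ℝ) (k : ℕ) : ℝ := (k : ℝ) * lamS / (n : ℝ)

/-- The rate `ν_m = ∑_{r ≠ m} q_{mr}` at which the source leaves state `m`. -/
def exitRate {M : ℕ} (q : Matrix (Fin M) (Fin M) ℝ) (m : Fin M) : ℝ :=
  ∑ r ∈ Finset.univ.erase m, q m r

end GossipNetwork

/-! Observed at the rings of the superposed clocks, the network is a discrete chain driven by i.i.d.
events independent of the ring times; its averaging operator is `step`. Versions are unbounded, but
both observables see only version differences. On such functions Doeblin's argument applies: from
every configuration a word of source transitions and pushes, of one fixed length, leads to the same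
synchronized configuration up to a shift of versions (`exists_sync_word`). Each application of such
a block shrinks the range of an observable by a fixed factor, so its expectation converges to a
value that forgets the start.

The word contains no gossip, so the factor is uniform over bounded gossip rates. Since each finite
iterate is continuous in the gossip rate, the long-run values are right-continuous at zero
(`exists_longRun`). The number of rings tends to infinity almost surely, and dominated convergence
carries the limits over to continuous time (`tendsto_integral_process`). Permuting the nodes shows
that only the cardinality of the node set matters.

Without gossip the equation for freshness closes: freshness in state `m` is lost at rate `ν_m` and,
while `Q = m`, restored at rate `α_k`. In the limit `g (ν_m + α_k) = α_k π_m` (`longRun_freshOn`).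
No formula for the accuracy is needed, only its continuity at zero. -/

namespace GossipNetwork

/-! ### The averaging operator of the jump chain -/

section OneStep

variable {M n : ℕ}

/-- One step of the jump chain in which the next event is `e` with weight `w e`, acting on
functions of the configuration. -/
noncomputable def step (w : Event M n → ℝ) (f : Config M n → ℝ) (z : Config M n) : ℝ :=
  ∑ e, w e * f (z.next e)

/-- Averaging is linear and fixes constants. The cases `r = ±1` turn two-sided bounds into
nonnegativity statements; `s = 0` pulls out scalars. -/
theorem iterate_step_affine {w : Event M n → ℝ} (hw1 : ∑ e, w e = 1) (r s : ℝ)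
    (f : Config M n → ℝ) (N : ℕ) (z : Config M n) :
    (step w)^[N] (fun y => r * f y + s) z = r * (step w)^[N] f z + s := by
  induction N generalizing z with
  | zero => rfl
  | succ N ih =>
    rw [Function.iterate_succ_apply', Function.iterate_succ_apply']
    simp only [step, ih, mul_add, Finset.sum_add_distrib, ← Finset.sum_mul, hw1, one_mul,
      Finset.mul_sum]
    congr 1
    exact Finset.sum_congr rfl fun e _ => by ring

theorem iterate_step_add {w : Event M n → ℝ} (f g : Config M n → ℝ) (N : ℕ) (z : Config M n) :
    (step w)^[N] (fun y => f y + g y) z = (step w)^[N] f z + (step w)^[N] g z := by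
  induction N generalizing z with
  | zero => rfl
  | succ N ih =>
    simp only [Function.iterate_succ_apply', step, ih, mul_add, Finset.sum_add_distrib]

theorem iterate_step_mono {w : Event M n → ℝ} (hw : ∀ e, 0 ≤ w e) {f g : Config M n → ℝ}
    (hfg : ∀ z, f z ≤ g z) (N : ℕ) (z : Config M n) :
    (step w)^[N] f z ≤ (step w)^[N] g z := by
  induction N generalizing z with
  | zero => exact hfg z
  | succ N ih =>
    simp only [Function.iterate_succ_apply', step]
    exact Finset.sum_le_sum fun e _ => mul_le_mul_of_nonneg_left (ih _) (hw e)

theorem iterate_step_const {w : Event M n → ℝ} (hw1 : ∑ e, w e = 1) (a : ℝ) (N : ℕ)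
    (z : Config M n) : (step w)^[N] (fun _ => a) z = a := by
  have h := iterate_step_affine hw1 0 a (fun _ => 0) N z
  simpa using h

theorem iterate_step_mem_Icc {w : Event M n → ℝ} (hw : ∀ e, 0 ≤ w e) (hw1 : ∑ e, w e = 1)
    {f : Config M n → ℝ} {a b : ℝ} (hf : ∀ z, f z ∈ Set.Icc a b) (N : ℕ) (z : Config M n) :
    (step w)^[N] f z ∈ Set.Icc a b := by
  constructor
  · simpa only [iterate_step_const hw1] using iterate_step_mono hw (fun y => (hf y).1) N z
  · simpa only [iterate_step_const hw1] using iterate_step_mono hw (fun y => (hf y).2) N z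

/-- Following a word whose letters all have weight at least `ρ`. -/
theorem pow_mul_le_iterate_step {w : Event M n → ℝ} (hw : ∀ e, 0 ≤ w e) {ρ : ℝ} (hρ : 0 ≤ ρ)
    {f : Config M n → ℝ} (hf : ∀ z, 0 ≤ f z) (l : List (Event M n)) (hl : ∀ e ∈ l, ρ ≤ w e)
    (z : Config M n) : ρ ^ l.length * f (l.foldl Config.next z) ≤ (step w)^[l.length] f z := by
  have hpos : ∀ N y, 0 ≤ (step w)^[N] f y := fun N y => by
    induction N generalizing y with
    | zero => exact hf y
    | succ N ih =>
      rw [Function.iterate_succ_apply']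
      exact Finset.sum_nonneg fun e _ => mul_nonneg (hw e) (ih _)
  induction l generalizing z with
  | nil => simp
  | cons e l ih =>
    rw [List.length_cons, Function.iterate_succ_apply', List.foldl_cons, pow_succ']
    have h1 := ih (fun e he => hl e (List.mem_cons_of_mem _ he)) (z.next e)
    calc ρ * ρ ^ l.length * f (l.foldl Config.next (z.next e))
        = ρ * (ρ ^ l.length * f (l.foldl Config.next (z.next e))) := by ring
      _ ≤ w e * (step w)^[l.length] f (z.next e) :=
          mul_le_mul (hl e List.mem_cons_self) h1 (mul_nonneg (pow_nonneg hρ _) (hf _)) (hw e)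
      _ ≤ _ := Finset.single_le_sum
          (f := fun e => w e * (step w)^[l.length] f (z.next e))
          (fun e _ => mul_nonneg (hw e) (hpos _ _)) (Finset.mem_univ e)

/-- An invariant `p` confines the chain, so identities valid only on `p` can be used under
iteration; needed because the freshness equation requires valid configurations. -/
theorem iterate_step_congr {w : Event M n → ℝ} {p : Config M n → Prop}
    (hp : ∀ z e, p z → p (z.next e)) {f g : Config M n → ℝ} (hfg : ∀ z, p z → f z = g z) (N : ℕ)
    {z : Config M n} (hz : p z) : (step w)^[N] f z = (step w)^[N] g z := by
  induction N generalizing z with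
  | zero => exact hfg z hz
  | succ N ih =>
    simp only [Function.iterate_succ_apply', step]
    exact Finset.sum_congr rfl fun e _ => by rw [ih (hp z e hz)]

end OneStep

/-! ### Invariance under a common shift of versions -/

section Shift

variable {M n : ℕ}

/-- All version numbers increased by `s`. -/
def Config.shift (z : Config M n) (s : ℕ) : Config M n :=
  { z with V₀ := z.V₀ + s, V := fun i => z.V i + s }

/-- The function depends on the version numbers only through their differences. -/
def ShiftInvariant (f : Config M n → ℝ) : Prop := ∀ z s, f (z.shift s) = f z

/-- Events only copy, increment and compare versions, and all three commute with adding a constant.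
-/
theorem Config.next_shift (z : Config M n) (s : ℕ) (e : Event M n) :
    (z.shift s).next e = (z.next e).shift s := by
  cases e with
  | source i j =>
    by_cases h : z.Q = i
    · simp only [next, shift, h, if_true]
      rw [add_right_comm]
    · simp [next, shift, h]
  | push j =>
    simp only [next, shift]
    ext i
    · rfl
    · rfl
    · by_cases h : i = j <;> simp [h]
    · rfl
  | gossip i j =>
    simp only [next, shift, add_lt_add_iff_right]
    split_ifs
    · ext r
      · rfl
      · rfl
      · by_cases h : r = j <;> simp [h]
      · rfl
    · rfl

theorem ShiftInvariant.iterate_step {f : Config M n → ℝ} (hf : ShiftInvariant f)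
    (w : Event M n → ℝ) (N : ℕ) : ShiftInvariant ((step w)^[N] f) := by
  induction N with
  | zero => exact hf
  | succ N ih =>
    intro z s
    simp only [Function.iterate_succ_apply', step, Config.next_shift]
    exact Finset.sum_congr rfl fun e _ => by rw [ih]

end Shift

/-! ### Synchronizing words -/

section Synchronization

variable {M n : ℕ}

/-- The events that have a positive rate whatever the gossip rate. -/
def Event.IsActive (q : Matrix (Fin M) (Fin M) ℝ) : Event M n → Prop
  | .source i j => i ≠ j ∧ 0 < q i j
  | .push _ => True
  | .gossip _ _ => False

/-- The configuration with all versions zero, the source and all nodes being in state `i`. -/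
def Config.sync (n : ℕ) (i : Fin M) : Config M n := ⟨i, 0, fun _ => 0, fun _ => i⟩

theorem exists_source_word {q : Matrix (Fin M) (Fin M) ℝ} {i j : Fin M}
    (h : Relation.ReflTransGen (fun a b => a ≠ b ∧ 0 < q a b) i j) :
    ∃ l : List (Event M n), (∀ e ∈ l, e.IsActive q) ∧
      ∀ z : Config M n, z.Q = i → (l.foldl Config.next z).Q = j := by
  induction h with
  | refl => exact ⟨[], by simp, fun z hz => hz⟩
  | @tail b c _ hbc ih =>
    obtain ⟨l, hl, hz⟩ := ih
    refine ⟨l ++ [.source b c], ?_, fun z h => ?_⟩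
    · intro e he
      rcases List.mem_append.1 he with he | he
      · exact hl e he
      · rw [List.mem_singleton.1 he]; exact hbc
    · simp [List.foldl_append, Config.next, hz z h]

theorem foldl_next_push (js : List (Fin n)) (z : Config M n) :
    ((js.map Event.push).foldl Config.next z).Q = z.Q ∧
    ((js.map Event.push).foldl Config.next z).V₀ = z.V₀ ∧
    ∀ j ∈ js, ((js.map Event.push).foldl Config.next z).V j = z.V₀ ∧
      ((js.map Event.push).foldl Config.next z).S j = z.Q := by
  induction js using List.reverseRecOn with
  | nil => simp
  | append_singleton js r ih =>
    obtain ⟨h1, h2, h3⟩ := ih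
    simp only [List.map_append, List.foldl_append, List.map_cons, List.map_nil, List.foldl_cons,
      List.foldl_nil, Config.next, h1, h2, true_and]
    intro j hj
    by_cases hjr : j = r
    · simp [hjr]
    · simp only [List.mem_append, List.mem_singleton, hjr, or_false] at hj
      simpa [hjr] using h3 j hj

/-- From every configuration a synchronized one is reached by a word of active events, whose
length does not depend on the configuration. -/
theorem exists_sync_word {q : Matrix (Fin M) (Fin M) ℝ} (hq : IsIrreducibleGenerator q)
    (hn : 1 ≤ n) (m : Fin M) :
    ∃ L : ℕ, ∀ z : Config M n, ∃ l : List (Event M n), l.length = L ∧ (∀ e ∈ l, e.IsActive q) ∧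
      ∃ v, l.foldl Config.next z = (Config.sync n m).shift v := by
  choose l hl hlQ using fun i => exists_source_word (n := n) (hq.irreducible i m)
  refine ⟨n + Finset.univ.sup fun i => (l i).length, fun z => ?_⟩
  have hle : (l z.Q).length ≤ Finset.univ.sup fun i => (l i).length :=
    Finset.le_sup (f := fun i => (l i).length) (Finset.mem_univ z.Q)
  set y := (l z.Q).foldl Config.next z with hy
  have hyQ : y.Q = m := hlQ z.Q z rfl
  -- Redundant pushes to node `0` pad the word, so that its length does not depend on the starting
  -- state.
  let js : List (Fin n) := List.replicate
    ((Finset.univ.sup fun i => (l i).length) - (l z.Q).length) ⟨0, hn⟩ ++ List.finRange n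
  have hjs : ∀ j, j ∈ js := fun j => List.mem_append_right _ (List.mem_finRange j)
  refine ⟨l z.Q ++ js.map Event.push, ?_, ?_, y.V₀, ?_⟩
  · simp only [js, List.length_append, List.length_map, List.length_replicate,
      List.length_finRange]
    omega
  · intro e he
    rcases List.mem_append.1 he with he | he
    · exact hl _ e he
    · obtain ⟨j, -, rfl⟩ := List.mem_map.1 he
      trivial
  · rw [List.foldl_append, ← hy]
    obtain ⟨h1, h2, h3⟩ := foldl_next_push js y
    ext j
    · simp [h1, hyQ, Config.shift, Config.sync]
    · simp [h2, Config.shift, Config.sync]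
    · simp [(h3 j (hjs j)).1, Config.shift, Config.sync]
    · simp [(h3 j (hjs j)).2, hyQ, Config.shift, Config.sync]

end Synchronization

/-! ### Doeblin contraction -/

section Contraction

variable {M n : ℕ}

/-- Doeblin's contraction: a word of weight at least `ρ ^ L` leads everywhere to the same value. -/
theorem exists_iterate_step_mem_Icc {w : Event M n → ℝ} (hw : ∀ e, 0 ≤ w e)
    (hw1 : ∑ e, w e = 1) {ρ : ℝ} (hρ : 0 ≤ ρ) {L : ℕ} {m : Fin M}
    (hword : ∀ z : Config M n, ∃ l : List (Event M n), l.length = L ∧ (∀ e ∈ l, ρ ≤ w e) ∧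
      ∃ v, l.foldl Config.next z = (Config.sync n m).shift v)
    {f : Config M n → ℝ} (hf : ShiftInvariant f) {a d : ℝ}
    (hfa : ∀ z, f z ∈ Set.Icc a (a + d)) :
    ∃ a', ∀ z, (step w)^[L] f z ∈ Set.Icc a' (a' + (1 - ρ ^ L) * d) := by
  -- With probability at least `ρ ^ L` the value is that at the synchronized configuration;
  -- otherwise it is at least `a`. The upper end comes from the same bound applied to `a + d - f`.
  refine ⟨a + ρ ^ L * (f (Config.sync n m) - a), fun z => ?_⟩
  obtain ⟨l, rfl, hl, v, hv⟩ := hword z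
  have h1 := pow_mul_le_iterate_step hw hρ (f := fun y => 1 * f y + -a)
    (fun y => by linarith [(hfa y).1]) l hl z
  have h2 := pow_mul_le_iterate_step hw hρ (f := fun y => -1 * f y + (a + d))
    (fun y => by linarith [(hfa y).2]) l hl z
  rw [iterate_step_affine hw1, hv, hf] at h1 h2
  constructor <;> nlinarith

theorem exists_iterate_step_mul_mem_Icc {w : Event M n → ℝ} (hw : ∀ e, 0 ≤ w e)
    (hw1 : ∑ e, w e = 1) {ρ : ℝ} (hρ : 0 ≤ ρ) {L : ℕ} {m : Fin M}
    (hword : ∀ z : Config M n, ∃ l : List (Event M n), l.length = L ∧ (∀ e ∈ l, ρ ≤ w e) ∧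
      ∃ v, l.foldl Config.next z = (Config.sync n m).shift v)
    {f : Config M n → ℝ} (hf : ShiftInvariant f) (hf01 : ∀ z, f z ∈ Set.Icc (0 : ℝ) 1) (K : ℕ) :
    ∃ a, ∀ z, (step w)^[K * L] f z ∈ Set.Icc a (a + (1 - ρ ^ L) ^ K) := by
  induction K with
  | zero => exact ⟨0, fun z => by simpa using hf01 z⟩
  | succ K ih =>
    obtain ⟨a, ha⟩ := ih
    obtain ⟨a', ha'⟩ := exists_iterate_step_mem_Icc hw hw1 hρ hword
      (hf.iterate_step w (K * L)) ha
    refine ⟨a', fun z => ?_⟩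
    rw [show (K + 1) * L = L + K * L by ring, Function.iterate_add_apply, pow_succ']
    exact ha' z

/-- Steps beyond `K * L` only average values already confined to a short interval. Varying `N` and
`z` together yields both the Cauchy property and independence of the start. -/
theorem abs_iterate_step_sub_le {w : Event M n → ℝ} (hw : ∀ e, 0 ≤ w e)
    (hw1 : ∑ e, w e = 1) {ρ : ℝ} (hρ : 0 ≤ ρ) {L : ℕ} {m : Fin M}
    (hword : ∀ z : Config M n, ∃ l : List (Event M n), l.length = L ∧ (∀ e ∈ l, ρ ≤ w e) ∧
      ∃ v, l.foldl Config.next z = (Config.sync n m).shift v)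
    {f : Config M n → ℝ} (hf : ShiftInvariant f) (hf01 : ∀ z, f z ∈ Set.Icc (0 : ℝ) 1) {K : ℕ}
    {N N' : ℕ} (hN : K * L ≤ N) (hN' : K * L ≤ N') (z z' : Config M n) :
    |(step w)^[N] f z - (step w)^[N'] f z'| ≤ (1 - ρ ^ L) ^ K := by
  obtain ⟨a, ha⟩ := exists_iterate_step_mul_mem_Icc hw hw1 hρ hword hf hf01 K
  obtain ⟨s, rfl⟩ := Nat.exists_eq_add_of_le' hN
  obtain ⟨s', rfl⟩ := Nat.exists_eq_add_of_le' hN'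
  rw [Function.iterate_add_apply, Function.iterate_add_apply]
  have h1 := iterate_step_mem_Icc hw hw1 ha s z
  have h2 := iterate_step_mem_Icc hw hw1 ha s' z'
  rw [abs_le]
  constructor <;> linarith [h1.1, h1.2, h2.1, h2.2]

end Contraction

/-! ### Dependence of the weights on the gossip rate -/

section Weights

variable {M n : ℕ}

/-- The probability that the next ring is that of the clock of `e`. -/
noncomputable def weight (q : Matrix (Fin M) (Fin M) ℝ) (lamS lam : ℝ) (e : Event M n) : ℝ :=
  rate q lamS lam e / totalRate n q lamS lam

theorem weight_nonneg {q : Matrix (Fin M) (Fin M) ℝ} (hq : IsIrreducibleGenerator q)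
    {lamS lam : ℝ} (hlamS : 0 < lamS) (hlam : 0 ≤ lam) (hn : 1 ≤ n) (e : Event M n) :
    0 ≤ weight q lamS lam e :=
  div_nonneg (rate_nonneg hq hlamS hlam e) (totalRate_pos hq hlamS hlam hn).le

theorem sum_weight {q : Matrix (Fin M) (Fin M) ℝ} (hq : IsIrreducibleGenerator q)
    {lamS lam : ℝ} (hlamS : 0 < lamS) (hlam : 0 ≤ lam) (hn : 1 ≤ n) :
    ∑ e : Event M n, weight q lamS lam e = 1 := by
  simp only [weight, ← Finset.sum_div]
  exact div_self (totalRate_pos hq hlamS hlam hn).ne'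

theorem rate_mono {q : Matrix (Fin M) (Fin M) ℝ} {lamS lam B : ℝ} (hB : lam ≤ B)
    (e : Event M n) : rate q lamS lam e ≤ rate q lamS B e := by
  cases e with
  | source i j => exact le_rfl
  | push j => exact le_rfl
  | gossip i j =>
    have hn : (1 : ℝ) ≤ (n : ℝ) := by
      exact_mod_cast (Nat.succ_le_of_lt (lt_of_le_of_lt (Nat.zero_le _) i.isLt))
    simp only [rate]
    split_ifs
    · exact le_rfl
    · exact div_le_div_of_nonneg_right hB (by linarith)

theorem continuous_rate (q : Matrix (Fin M) (Fin M) ℝ) (lamS : ℝ) (e : Event M n) :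
    Continuous fun lam => rate q lamS lam e := by
  cases e with
  | source i j => exact continuous_const
  | push j => exact continuous_const
  | gossip i j =>
    simp only [rate]
    split_ifs <;> fun_prop

theorem tendsto_weight {q : Matrix (Fin M) (Fin M) ℝ} (hq : IsIrreducibleGenerator q)
    {lamS : ℝ} (hlamS : 0 < lamS) (hn : 1 ≤ n) (e : Event M n) :
    Tendsto (fun lam => weight q lamS lam e) (𝓝[>] 0) (𝓝 (weight q lamS 0 e)) := by
  refine Tendsto.mono_left (Tendsto.div ((continuous_rate q lamS e).tendsto 0) ?_
    (totalRate_pos hq hlamS le_rfl hn).ne') nhdsWithin_le_nhds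
  exact tendsto_finsetSum _ fun e _ => (continuous_rate q lamS e).tendsto 0

theorem tendsto_iterate_step_weight {q : Matrix (Fin M) (Fin M) ℝ}
    (hq : IsIrreducibleGenerator q) {lamS : ℝ} (hlamS : 0 < lamS) (hn : 1 ≤ n)
    (f : Config M n → ℝ) (N : ℕ) (z : Config M n) :
    Tendsto (fun lam => (step (weight q lamS lam))^[N] f z) (𝓝[>] 0)
      (𝓝 ((step (weight q lamS 0))^[N] f z)) := by
  induction N generalizing z with
  | zero => exact tendsto_const_nhds
  | succ N ih =>
    simp only [Function.iterate_succ_apply', step]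
    exact tendsto_finsetSum _ fun e _ => (tendsto_weight hq hlamS hn e).mul (ih _)

/-- The weights of the active events are bounded below uniformly in bounded gossip rates. -/
theorem exists_le_weight {q : Matrix (Fin M) (Fin M) ℝ} (hq : IsIrreducibleGenerator q)
    {lamS : ℝ} (hlamS : 0 < lamS) (hn : 1 ≤ n) {B : ℝ} (hB : 0 ≤ B) :
    ∃ ρ : ℝ, 0 < ρ ∧ ρ ≤ 1 ∧ ∀ lam, 0 ≤ lam → lam ≤ B → ∀ e : Event M n, e.IsActive q →
      ρ ≤ weight q lamS lam e := by
  classical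
  have hTB := totalRate_pos (n := n) hq hlamS hB hn
  obtain ⟨e₀, he₀, hmin⟩ := Finset.exists_min_image
    (Finset.univ.filter fun e : Event M n => e.IsActive q) (rate q lamS B)
    ⟨Event.push ⟨0, hn⟩, Finset.mem_filter.2 ⟨Finset.mem_univ _, trivial⟩⟩
  have hactive : ∀ e : Event M n, e.IsActive q →
      0 < rate q lamS B e ∧ ∀ lam, rate q lamS lam e = rate q lamS B e := by
    rintro (⟨i, j⟩ | j | ⟨i, j⟩) he
    · exact ⟨by simpa [rate, he.1] using he.2, fun _ => rfl⟩
    · have hn' : (0 : ℝ) < n := by exact_mod_cast hn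
      exact ⟨by simp only [rate]; positivity, fun _ => rfl⟩
    · exact he.elim
  have hpos := (hactive e₀ (by simpa using he₀)).1
  -- Active rates do not involve the gossip rate, while the total rate is largest at `B`: the
  -- smallest active weight at `B` works throughout `[0, B]`.
  refine ⟨rate q lamS B e₀ / totalRate n q lamS B, div_pos hpos hTB, ?_, ?_⟩
  · rw [div_le_one hTB]
    exact Finset.single_le_sum (fun e _ => rate_nonneg hq hlamS hB e) (Finset.mem_univ e₀)
  · intro lam h0 h1 e he
    rw [weight, (hactive e he).2 lam]
    exact div_le_div₀ (hactive e he).1.le (hmin e (by simpa using he))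
      (totalRate_pos hq hlamS h0 hn) (Finset.sum_le_sum fun e _ => rate_mono h1 e)

end Weights

/-! ### Long-run values and their continuity at zero gossip -/

section LongRun

variable {M n : ℕ}

/-- `L` and `r` are chosen before `lam`; this uniformity is what allows the limits in `N` and in
`lam` to be exchanged. -/
theorem exists_uniform_rate {q : Matrix (Fin M) (Fin M) ℝ} (hq : IsIrreducibleGenerator q)
    {lamS : ℝ} (hlamS : 0 < lamS) (hn : 1 ≤ n) (m : Fin M) {B : ℝ} (hB : 0 ≤ B) :
    ∃ (L : ℕ) (r : ℝ), 0 ≤ r ∧ r < 1 ∧ ∀ lam, 0 ≤ lam → lam ≤ B →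
      ∀ f : Config M n → ℝ, ShiftInvariant f → (∀ z, f z ∈ Set.Icc (0 : ℝ) 1) →
      ∀ K N N' : ℕ, K * L ≤ N → K * L ≤ N' → ∀ z z' : Config M n,
        |(step (weight q lamS lam))^[N] f z - (step (weight q lamS lam))^[N'] f z'| ≤ r ^ K := by
  obtain ⟨L, hL⟩ := exists_sync_word hq hn m
  obtain ⟨ρ, hρ, hρ1, hle⟩ := exists_le_weight (n := n) hq hlamS hn hB
  refine ⟨L, 1 - ρ ^ L, by linarith [pow_le_one₀ hρ.le hρ1 (n := L)], by linarith [pow_pos hρ L],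
    ?_⟩
  intro lam h0 h1 f hf hf01 K N N' hN hN' z z'
  refine abs_iterate_step_sub_le (weight_nonneg hq hlamS h0 hn) (sum_weight hq hlamS h0 hn) hρ.le
    (m := m) (fun y => ?_) hf hf01 hN hN' z z'
  obtain ⟨l, h1', h2, h3⟩ := hL y
  exact ⟨l, h1', fun e he => hle lam h0 h1 e (h2 e he), h3⟩

/-- The long-run value of an observable of the jump chain exists, does not depend on the start, and
is right-continuous in the gossip rate at zero. -/
theorem exists_longRun {q : Matrix (Fin M) (Fin M) ℝ} (hq : IsIrreducibleGenerator q)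
    {lamS : ℝ} (hlamS : 0 < lamS) (hn : 1 ≤ n) (m : Fin M) {f : Config M n → ℝ}
    (hf : ShiftInvariant f) (hf01 : ∀ z, f z ∈ Set.Icc (0 : ℝ) 1) :
    ∃ c : ℝ → ℝ, (∀ lam, 0 ≤ lam → ∀ z,
        Tendsto (fun N => (step (weight q lamS lam))^[N] f z) atTop (𝓝 (c lam))) ∧
      Tendsto c (𝓝[>] 0) (𝓝 (c 0)) := by
  have hlim : ∀ lam : ℝ, ∃ c : ℝ, 0 ≤ lam → ∀ z,
      Tendsto (fun N => (step (weight q lamS lam))^[N] f z) atTop (𝓝 c) := by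
    intro lam
    by_cases h0 : 0 ≤ lam
    swap
    · exact ⟨0, fun h => absurd h h0⟩
    obtain ⟨L, r, hr0, hr1, hle⟩ := exists_uniform_rate hq hlamS hn m h0
    have hpow := tendsto_pow_atTop_nhds_zero_of_lt_one hr0 hr1
    have hcau : CauchySeq fun N => (step (weight q lamS lam))^[N] f (Config.sync n m) := by
      rw [Metric.cauchySeq_iff']
      intro ε hε
      obtain ⟨K, hK⟩ := (hpow.eventually_lt_const hε).exists
      exact ⟨K * L, fun N hN => (hle lam h0 le_rfl f hf hf01 K N _ hN le_rfl _ _).trans_lt hK⟩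
    obtain ⟨c, hc⟩ := cauchySeq_tendsto_of_complete hcau
    refine ⟨c, fun _ z => ?_⟩
    refine hc.congr_dist ?_
    rw [Metric.tendsto_atTop]
    intro ε hε
    obtain ⟨K, hK⟩ := (hpow.eventually_lt_const hε).exists
    refine ⟨K * L, fun N hN => ?_⟩
    rw [Real.dist_0_eq_abs, abs_of_nonneg dist_nonneg]
    exact (hle lam h0 le_rfl f hf hf01 K N N hN hN _ _).trans_lt hK
  choose c hc using hlim
  refine ⟨c, hc, ?_⟩
  obtain ⟨L, r, hr0, hr1, hle⟩ := exists_uniform_rate hq hlamS hn m zero_le_one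
  have hpow := tendsto_pow_atTop_nhds_zero_of_lt_one hr0 hr1
  have hclose : ∀ lam, 0 ≤ lam → lam ≤ 1 → ∀ K,
      |(step (weight q lamS lam))^[K * L] f (Config.sync n m) - c lam| ≤ r ^ K := by
    intro lam h0 h1 K
    refine le_of_tendsto ((tendsto_const_nhds.sub (hc lam h0 (Config.sync n m))).abs) ?_
    filter_upwards [eventually_ge_atTop (K * L)] with N hN
    exact hle lam h0 h1 f hf hf01 K _ _ le_rfl hN _ _
  rw [Metric.tendsto_nhds]
  intro ε hε
  -- Both long-run values are within `ε / 3` of their iterates at the common time `K * L`, and these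
  -- finite iterates are close by continuity in `lam`.
  obtain ⟨K, hK⟩ := (hpow.eventually_lt_const (show 0 < ε / 3 by positivity)).exists
  have hnear := Metric.tendsto_nhds.1
    (tendsto_iterate_step_weight hq hlamS hn f (K * L) (Config.sync n m)) (ε / 3) (by positivity)
  filter_upwards [hnear, Ioo_mem_nhdsGT (zero_lt_one' ℝ)] with lam h1 h2
  have h3 := hclose lam h2.1.le h2.2.le K
  have h4 := hclose 0 le_rfl zero_le_one K
  rw [Real.dist_eq] at h1 ⊢
  rw [abs_lt] at h1 ⊢
  rw [abs_le] at h3 h4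
  constructor <;> linarith [h1.1, h1.2, h3.1, h3.2, h4.1, h4.2]

end LongRun

/-! ### Law of the jump chain -/

section Events

variable {M n : ℕ}

theorem configAfter_congr (z : Config M n) {ev ev' : ℕ → Event M n} {N : ℕ}
    (h : ∀ i < N, ev i = ev' i) : configAfter z ev N = configAfter z ev' N := by
  induction N with
  | zero => rfl
  | succ N ih =>
    rw [configAfter, configAfter, ih fun i hi => h i (by omega), h N (by omega)]

/-- Factoring through finitely many coordinates of a finite discrete space makes measurability,
integrability and independence automatic, without a σ-algebra on configurations. -/
theorem exists_configAfter_eq_restrict (z : Config M n) (N : ℕ) :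
    ∃ G : (Finset.range N → Event M n) → Config M n,
      ∀ ev, configAfter z ev N = G fun i => ev i := by
  classical
  by_cases hE : Nonempty (Event M n)
  · obtain ⟨e₀⟩ := hE
    refine ⟨fun x => configAfter z
      (fun i => if h : i ∈ Finset.range N then x ⟨i, h⟩ else e₀) N, fun ev => ?_⟩
    refine configAfter_congr z fun i hi => ?_
    simp [hi]
  · exact ⟨fun _ => z, fun ev => (hE ⟨ev 0⟩).elim⟩

theorem measurable_configAfter (z : Config M n) (f : Config M n → ℝ) (N : ℕ) :
    Measurable fun ev : ℕ → Event M n => f (configAfter z ev N) := by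
  obtain ⟨G, hG⟩ := exists_configAfter_eq_restrict z N
  simp only [hG]
  exact (Measurable.of_discrete (f := fun x => f (G x))).comp
    (measurable_pi_lambda _ fun i => measurable_pi_apply _)

theorem integrable_configAfter {μ : Measure (ℕ → Event M n)} [IsFiniteMeasure μ]
    (z : Config M n) (f : Config M n → ℝ) (N : ℕ) :
    Integrable (fun ev : ℕ → Event M n => f (configAfter z ev N)) μ := by
  obtain ⟨G, hG⟩ := exists_configAfter_eq_restrict z N
  simp only [hG]
  have hm : Measurable fun (ev : ℕ → Event M n) (i : Finset.range N) => ev i :=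
    measurable_pi_lambda _ fun i => measurable_pi_apply _
  exact (Integrable.of_finite (μ := μ.map fun ev (i : Finset.range N) => ev i)
    (f := fun x => f (G x))).comp_measurable hm

theorem eventLaw_real_singleton {q : Matrix (Fin M) (Fin M) ℝ} (hq : IsIrreducibleGenerator q)
    {lamS lam : ℝ} (hlamS : 0 < lamS) (hlam : 0 ≤ lam) (hn : 1 ≤ n) (e : Event M n) :
    (eventLaw n q lamS lam).real {e} = weight q lamS lam e := by
  classical
  rw [measureReal_def, eventLaw, Measure.finsetSum_apply, Finset.sum_eq_single e]
  · simp only [Measure.smul_apply, smul_eq_mul]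
    rw [Measure.dirac_apply' _ (MeasurableSet.singleton e)]
    rw [Set.indicator_of_mem (Set.mem_singleton e), Pi.one_apply, mul_one]
    exact ENNReal.toReal_ofReal (weight_nonneg hq hlamS hlam hn e)
  · intro b _ hb
    simp only [Measure.smul_apply, smul_eq_mul]
    rw [Measure.dirac_apply' _ (MeasurableSet.singleton e)]
    simp [hb]
  · simp

/-- The jump chain: the expectation of an observable after `N` events. -/
theorem integral_configAfter {q : Matrix (Fin M) (Fin M) ℝ} (hq : IsIrreducibleGenerator q)
    {lamS lam : ℝ} (hlamS : 0 < lamS) (hlam : 0 ≤ lam) (hn : 1 ≤ n) (z : Config M n) (N : ℕ)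
    (f : Config M n → ℝ) :
    ∫ ev, f (configAfter z ev N) ∂(Measure.infinitePi fun _ : ℕ => eventLaw n q lamS lam) =
      (step (weight q lamS lam))^[N] f z := by
  classical
  have := isProbabilityMeasure_eventLaw (n := n) hq hlamS hlam hn
  set μ := Measure.infinitePi fun _ : ℕ => eventLaw n q lamS lam with hμ
  induction N generalizing f with
  | zero => simp [configAfter]
  | succ N ih =>
    have hsplit : ∀ ev : ℕ → Event M n, f (configAfter z ev (N + 1)) =
        ∑ e, (if ev N = e then (1 : ℝ) else 0) * f ((configAfter z ev N).next e) := by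
      intro ev
      simp [configAfter]
    -- Event number `N` is independent of events `0, …, N - 1`, which determine the configuration
    -- before it.
    have hind : ∀ e : Event M n,
        IndepFun (fun ev : ℕ → Event M n => if ev N = e then (1 : ℝ) else 0)
          (fun ev => f ((configAfter z ev N).next e)) μ := by
      intro e
      obtain ⟨G, hG⟩ := exists_configAfter_eq_restrict z N
      have h1 : iIndepFun (fun (i : ℕ) (ev : ℕ → Event M n) => ev i) μ :=
        iIndepFun_infinitePi (X := fun _ x => x) fun _ => measurable_id
      have h2 := h1.indepFun_finset {N} (Finset.range N) (by simp)
        fun i => measurable_pi_apply i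
      have h3 := h2.comp
        (φ := fun x => if x ⟨N, by simp⟩ = e then (1 : ℝ) else 0)
        (ψ := fun x => f ((G x).next e)) Measurable.of_discrete Measurable.of_discrete
      simpa only [Function.comp_def, ← hG] using h3
    have hprob : ∀ e : Event M n,
        ∫ ev, (if ev N = e then (1 : ℝ) else 0) ∂μ = weight q lamS lam e := by
      intro e
      rw [← eventLaw_real_singleton hq hlamS hlam hn e]
      have hmp := measurePreserving_eval_infinitePi (fun _ : ℕ => eventLaw n q lamS lam) N
      rw [← hmp.map_eq, map_measureReal_apply hmp.measurable (MeasurableSet.singleton e),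
        ← integral_indicator_one (hmp.measurable (MeasurableSet.singleton e))]
      refine integral_congr_ae (ae_of_all _ fun ev => ?_)
      simp [Set.indicator_apply]
    have hmeas : ∀ e : Event M n,
        Measurable fun ev : ℕ → Event M n => if ev N = e then (1 : ℝ) else 0 := fun e =>
      (Measurable.of_discrete (f := fun x => if x = e then (1 : ℝ) else 0)).comp
        (measurable_pi_apply N)
    have hint : ∀ e : Event M n, Integrable (fun ev : ℕ → Event M n =>
        (if ev N = e then (1 : ℝ) else 0) * f ((configAfter z ev N).next e)) μ := by
      intro e
      refine (integrable_configAfter z (fun y => f (y.next e)) N).bdd_mul (c := 1)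
        (hmeas e).aestronglyMeasurable (ae_of_all _ fun ev => ?_)
      split_ifs <;> simp
    simp only [hsplit]
    rw [integral_finsetSum _ fun e _ => hint e, Function.iterate_succ_apply, ← ih]
    simp only [step]
    rw [integral_finsetSum _ fun e _ =>
      (integrable_configAfter z (fun y => f (y.next e)) N).const_mul _]
    refine Finset.sum_congr rfl fun e _ => ?_
    rw [(hind e).integral_fun_mul_eq_mul_integral (hmeas e).aestronglyMeasurable
      (measurable_configAfter z (fun y => f (y.next e)) N).aestronglyMeasurable, hprob,
      integral_const_mul]

end Events

/-! ### The number of rings -/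

section Clock

theorem measurable_ringCount (t : ℝ) : Measurable fun τ : ℕ → ℝ => ringCount τ t := by
  have hS : ∀ N : ℕ, MeasurableSet {τ : ℕ → ℝ | t < ∑ i ∈ Finset.range (N + 1), τ i} := fun N =>
    measurableSet_lt measurable_const
      (Finset.measurable_sum _ fun i _ => measurable_pi_apply i)
  refine measurable_to_countable' fun k => ?_
  -- The second piece is the case of no admissible `N`, where `sInf ∅ = 0`.
  have heq : (fun τ : ℕ → ℝ => ringCount τ t) ⁻¹' {k} =
      ({τ | t < ∑ i ∈ Finset.range (k + 1), τ i} ∩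
        ⋂ j ∈ Finset.range k, {τ | t < ∑ i ∈ Finset.range (j + 1), τ i}ᶜ) ∪
      ({_τ | k = 0} ∩ ⋂ j : ℕ, {τ | t < ∑ i ∈ Finset.range (j + 1), τ i}ᶜ) := by
    ext τ
    simp only [Set.mem_preimage, Set.mem_singleton_iff, Set.mem_union, Set.mem_inter_iff,
      Set.mem_ofPred_eq, Set.mem_iInter, Set.mem_compl_iff, Finset.mem_range]
    constructor
    · intro h
      rcases Set.eq_empty_or_nonempty {N : ℕ | t < ∑ i ∈ Finset.range (N + 1), τ i} with h0 | h0
      · right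
        refine ⟨?_, fun j hj => ?_⟩
        · rw [← h, ringCount, h0, Nat.sInf_empty]
        · exact (Set.eq_empty_iff_forall_notMem.1 h0 j) hj
      · left
        subst h
        exact ⟨Nat.sInf_mem h0, fun j hj => Nat.notMem_of_lt_sInf hj⟩
    · rintro (⟨h1, h2⟩ | ⟨rfl, h2⟩)
      · refine le_antisymm (Nat.sInf_le h1) ?_
        by_contra hlt
        exact h2 _ (not_le.1 hlt)
          (Nat.sInf_mem (s := {N : ℕ | t < ∑ i ∈ Finset.range (N + 1), τ i}) ⟨k, h1⟩)
      · have h0 : {N : ℕ | t < ∑ i ∈ Finset.range (N + 1), τ i} = ∅ :=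
          Set.eq_empty_iff_forall_notMem.2 h2
        rw [ringCount, h0, Nat.sInf_empty]
  rw [heq]
  refine ((hS k).inter (Finset.measurableSet_biInter _ fun j _ => (hS j).compl)).union
    ((MeasurableSet.const _).inter (MeasurableSet.iInter fun j => (hS j).compl))

theorem expMeasure_Iic_zero {r : ℝ} (hr : 0 < r) : expMeasure r (Set.Iic 0) = 0 := by
  have := isProbabilityMeasure_expMeasure hr
  rw [← measureReal_eq_zero_iff, ← cdf_eq_real, cdf_expMeasure_eq hr]
  simp

theorem expMeasure_Ioi_one {r : ℝ} (hr : 0 < r) : expMeasure r (Set.Ioi 1) ≠ 0 := by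
  have := isProbabilityMeasure_expMeasure hr
  rw [← Set.compl_Iic, ← measureReal_ne_zero_iff, probReal_compl_eq_one_sub measurableSet_Iic,
    ← cdf_eq_real, cdf_expMeasure_eq hr]
  simp [Real.exp_ne_zero]

/-- By the second Borel–Cantelli lemma infinitely many waiting times exceed `1`, so the ring times
diverge and each count is a genuine minimum. Once `t` passes the `K`-th ring time, the count is at
least `K`. -/
theorem ae_tendsto_ringCount {r : ℝ} (hr : 0 < r) :
    ∀ᵐ τ ∂(Measure.infinitePi fun _ : ℕ => expMeasure r),
      Tendsto (fun t => ringCount τ t) atTop atTop := by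
  have := isProbabilityMeasure_expMeasure hr
  set μ := Measure.infinitePi fun _ : ℕ => expMeasure r with hμ
  have hmp := fun i : ℕ => measurePreserving_eval_infinitePi (fun _ : ℕ => expMeasure r) i
  have hpos : ∀ᵐ τ ∂μ, ∀ i : ℕ, 0 < τ i := by
    rw [ae_all_iff]
    intro i
    have h := (hmp i).measure_preimage (s := Set.Iic 0) measurableSet_Iic.nullMeasurableSet
    rw [expMeasure_Iic_zero hr] at h
    filter_upwards [measure_eq_zero_iff_ae_notMem.1 h] with τ hτ
    simpa using hτ
  have hfreq : ∀ᵐ τ ∂μ, ∃ᶠ i in atTop, 1 < τ i := by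
    have hind : iIndepSet (fun i : ℕ => {τ : ℕ → ℝ | 1 < τ i}) μ := by
      have h1 : iIndepFun (fun (i : ℕ) (τ : ℕ → ℝ) => τ i) μ :=
        iIndepFun_infinitePi (X := fun _ x => x) fun _ => measurable_id
      rw [iIndepSet_iff_meas_biInter fun i =>
        measurableSet_lt measurable_const (measurable_pi_apply i)]
      exact fun s => h1.meas_biInter fun i _ => ⟨Set.Ioi 1, measurableSet_Ioi, rfl⟩
    have hmeas : ∀ i : ℕ, MeasurableSet {τ : ℕ → ℝ | 1 < τ i} := fun i =>
      measurableSet_lt measurable_const (measurable_pi_apply i)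
    have hsum : ∑' i : ℕ, μ {τ : ℕ → ℝ | 1 < τ i} = ⊤ := by
      have : ∀ i : ℕ, μ {τ : ℕ → ℝ | 1 < τ i} = expMeasure r (Set.Ioi 1) := fun i =>
        (hmp i).measure_preimage (s := Set.Ioi 1) measurableSet_Ioi.nullMeasurableSet
      simp only [this]
      exact ENNReal.tsum_const_eq_top_of_ne_zero (expMeasure_Ioi_one hr)
    have h := measure_limsup_eq_one hmeas hind hsum
    have hm : MeasurableSet (limsup (fun i : ℕ => {τ : ℕ → ℝ | 1 < τ i}) atTop) :=
      MeasurableSet.measurableSet_limsup hmeas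
    filter_upwards [(mem_ae_iff_prob_eq_one hm).2 h] with τ hτ
    exact mem_limsup_iff_frequently_mem.1 hτ
  filter_upwards [hpos, hfreq] with τ hτ hf
  have hmono : Monotone fun N => ∑ i ∈ Finset.range N, τ i :=
    monotone_nat_of_le_succ fun N => by
      rw [Finset.sum_range_succ]; linarith [hτ N]
  have hunb : ∀ k : ℕ, ∃ N, (k : ℝ) ≤ ∑ i ∈ Finset.range N, τ i := by
    intro k
    induction k with
    | zero => exact ⟨0, by simp⟩
    | succ k ih =>
      obtain ⟨N, hN⟩ := ih
      obtain ⟨i, hi, h1⟩ := (frequently_atTop.1 hf) N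
      refine ⟨i + 1, ?_⟩
      rw [Finset.sum_range_succ]
      push_cast
      linarith [hmono hi]
  rw [tendsto_atTop]
  intro K
  filter_upwards [eventually_ge_atTop (∑ i ∈ Finset.range K, τ i)] with t ht
  have hne : {N : ℕ | t < ∑ i ∈ Finset.range (N + 1), τ i}.Nonempty := by
    obtain ⟨k, hk⟩ := exists_nat_gt t
    obtain ⟨N, hN⟩ := hunb k
    exact ⟨N, hk.trans_le (hN.trans (hmono N.le_succ))⟩
  have h1 := Nat.sInf_mem hne
  by_contra hlt
  exact absurd (h1.trans_le (hmono (show ringCount τ t + 1 ≤ K by omega))) (not_lt.2 ht)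

end Clock

/-! ### Passage to continuous time -/

section Trajectory

variable {M n : ℕ}

theorem measurable_process (z : Config M n) (f : Config M n → ℝ) (t : ℝ) :
    Measurable fun ω : Sample M n => f (process z t ω) := by
  have h : Measurable fun x : ℕ × (ℕ → Event M n) => f (configAfter z x.2 x.1) :=
    measurable_from_prod_countable_right fun N => measurable_configAfter z f N
  exact h.comp (((measurable_ringCount t).comp measurable_fst).prodMk measurable_snd)

theorem integral_process {q : Matrix (Fin M) (Fin M) ℝ} (hq : IsIrreducibleGenerator q)
    {lamS lam : ℝ} (hlamS : 0 < lamS) (hlam : 0 ≤ lam) (hn : 1 ≤ n) (z : Config M n)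
    {f : Config M n → ℝ} (hf01 : ∀ z, f z ∈ Set.Icc (0 : ℝ) 1) (t : ℝ) :
    ∫ ω, f (process z t ω) ∂(clockLaw n q lamS lam) =
      ∫ τ, (step (weight q lamS lam))^[ringCount τ t] f z
        ∂(Measure.infinitePi fun _ : ℕ => expMeasure (totalRate n q lamS lam)) := by
  have := isProbabilityMeasure_eventLaw (n := n) hq hlamS hlam hn
  have := isProbabilityMeasure_expMeasure (totalRate_pos (n := n) hq hlamS hlam hn)
  have hint : Integrable (fun ω => f (process z t ω)) (clockLaw n q lamS lam) := by
    have := isProbabilityMeasure_clockLaw (n := n) hq hlamS hlam hn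
    refine Integrable.of_bound (measurable_process z f t).aestronglyMeasurable 1
      (ae_of_all _ fun ω => ?_)
    rw [Real.norm_of_nonneg (hf01 _).1]
    exact (hf01 _).2
  rw [clockLaw, integral_prod _ hint]
  exact integral_congr_ae (ae_of_all _ fun τ =>
    integral_configAfter hq hlamS hlam hn z (ringCount τ t) f)

theorem tendsto_integral_process {q : Matrix (Fin M) (Fin M) ℝ} (hq : IsIrreducibleGenerator q)
    {lamS lam : ℝ} (hlamS : 0 < lamS) (hlam : 0 ≤ lam) (hn : 1 ≤ n) (z : Config M n)
    {f : Config M n → ℝ} (hf01 : ∀ z, f z ∈ Set.Icc (0 : ℝ) 1) {c : ℝ}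
    (hc : Tendsto (fun N => (step (weight q lamS lam))^[N] f z) atTop (𝓝 c)) :
    Tendsto (fun t => ∫ ω, f (process z t ω) ∂(clockLaw n q lamS lam)) atTop (𝓝 c) := by
  have hr := totalRate_pos (n := n) hq hlamS hlam hn
  have := isProbabilityMeasure_expMeasure hr
  simp only [integral_process hq hlamS hlam hn z hf01]
  have h : c = ∫ _, c ∂(Measure.infinitePi fun _ : ℕ => expMeasure (totalRate n q lamS lam)) := by
    simp
  rw [h]
  refine tendsto_integral_filter_of_dominated_convergence (fun _ => 1) ?_ ?_
    (integrable_const 1) ?_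
  · exact Eventually.of_forall fun t => ((Measurable.of_discrete
      (f := fun N => (step (weight q lamS lam))^[N] f z)).comp
        (measurable_ringCount t)).aestronglyMeasurable
  · refine Eventually.of_forall fun t => ae_of_all _ fun τ => ?_
    have h1 := iterate_step_mem_Icc (weight_nonneg hq hlamS hlam hn) (sum_weight hq hlamS hlam hn)
      hf01 (ringCount τ t) z
    rw [Real.norm_of_nonneg h1.1]
    exact h1.2
  · filter_upwards [ae_tendsto_ringCount hr] with τ hτ
    exact hc.comp hτ

end Trajectory

/-! ### Symmetry under permutations of the nodes -/

section Relabel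

variable {M n : ℕ}

/-- The nodes relabelled: node `i` takes over the packet of node `σ i`. -/
def Config.relabel (z : Config M n) (σ : Equiv.Perm (Fin n)) : Config M n :=
  { z with V := z.V ∘ σ, S := z.S ∘ σ }

/-- The event that corresponds to `e` once the nodes are relabelled by `σ`. -/
def Event.relabel (σ : Equiv.Perm (Fin n)) (e : Event M n) : Event M n :=
  match e with
  | .source i j => .source i j
  | .push j => .push (σ.symm j)
  | .gossip i j => .gossip (σ.symm i) (σ.symm j)

theorem Event.relabel_symm_relabel (σ : Equiv.Perm (Fin n)) (e : Event M n) :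
    (e.relabel σ).relabel σ.symm = e := by
  cases e <;> simp [relabel]

/-- Relabelling of the events, as an equivalence. -/
def Event.relabelEquiv (M : ℕ) (σ : Equiv.Perm (Fin n)) : Event M n ≃ Event M n where
  toFun := Event.relabel σ
  invFun := Event.relabel σ.symm
  left_inv := Event.relabel_symm_relabel σ
  right_inv := Event.relabel_symm_relabel σ.symm

theorem Config.next_relabel (z : Config M n) (σ : Equiv.Perm (Fin n)) (e : Event M n) :
    (z.relabel σ).next (e.relabel σ) = (z.next e).relabel σ := by
  cases e with
  | source i j =>
    by_cases h : z.Q = i <;> simp [next, relabel, Event.relabel, h]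
  | push j => simp [next, relabel, Event.relabel, Function.update_comp_equiv]
  | gossip i j =>
    by_cases h : z.V j < z.V i <;>
      simp [next, relabel, Event.relabel, Function.update_comp_equiv, h]

theorem weight_relabel (q : Matrix (Fin M) (Fin M) ℝ) (lamS lam : ℝ) (σ : Equiv.Perm (Fin n))
    (e : Event M n) : weight q lamS lam (e.relabel σ) = weight q lamS lam e := by
  cases e <;> simp [weight, rate, Event.relabel]

/-- All nodes have the same push rate and all ordered pairs the same gossip rate, so relabelling
events permutes the sum defining `step` without changing weights. -/
theorem iterate_step_relabel (q : Matrix (Fin M) (Fin M) ℝ) (lamS lam : ℝ)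
    (σ : Equiv.Perm (Fin n)) (f : Config M n → ℝ) (N : ℕ) (z : Config M n) :
    (step (weight q lamS lam))^[N] (fun y => f (y.relabel σ)) z =
      (step (weight q lamS lam))^[N] f (z.relabel σ) := by
  induction N generalizing z with
  | zero => rfl
  | succ N ih =>
    simp only [Function.iterate_succ_apply', step, ih]
    refine Fintype.sum_equiv (Event.relabelEquiv M σ) _ _ fun e => ?_
    show _ = weight q lamS lam (e.relabel σ) *
      (step (weight q lamS lam))^[N] f ((z.relabel σ).next (e.relabel σ))
    rw [weight_relabel, Config.next_relabel]

theorem exists_perm_map_eq {A B : Finset (Fin n)} (h : A.card = B.card) :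
    ∃ σ : Equiv.Perm (Fin n), A.map σ.toEmbedding = B := by
  let e : {x // x ∈ A} ≃ {x // x ∈ B} := Finset.equivOfCardEq h
  refine ⟨e.extendSubtype, Finset.eq_of_subset_of_card_le ?_ (by simp [h])⟩
  intro x hx
  obtain ⟨y, hy, rfl⟩ := Finset.mem_map.1 hx
  exact e.extendSubtype_mem y hy

theorem Config.accuracy_relabel (z : Config M n) (σ : Equiv.Perm (Fin n)) (A : Finset (Fin n)) :
    (z.relabel σ).accuracy A = z.accuracy (A.map σ.toEmbedding) := by
  simp only [accuracy, Finset.sum_map, Finset.card_map]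
  rfl

theorem Config.setAge_relabel (z : Config M n) (σ : Equiv.Perm (Fin n)) {A : Finset (Fin n)}
    (hA : A.Nonempty) :
    (z.relabel σ).setAge A hA = z.setAge (A.map σ.toEmbedding) (hA.map) := by
  simp only [setAge, Finset.inf'_map]
  rfl

end Relabel

/-! ### Accuracy and freshness as observables -/

section Observables

variable {M n : ℕ}

/-- `C_A 1{Q = m}`. -/
noncomputable def accuracyOn (A : Finset (Fin n)) (m : Fin M) (z : Config M n) : ℝ :=
  if z.Q = m then z.accuracy A else 0

/-- The indicator of `Q = m, X_A = 0`. -/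
noncomputable def freshOn (A : Finset (Fin n)) (hA : A.Nonempty) (m : Fin M) (z : Config M n) :
    ℝ :=
  if z.Q = m ∧ z.setAge A hA = 0 then 1 else 0

theorem shiftInvariant_accuracyOn (A : Finset (Fin n)) (m : Fin M) :
    ShiftInvariant (accuracyOn A m) := fun _ _ => rfl

theorem Config.age_shift (z : Config M n) (s : ℕ) : (z.shift s).age = z.age := by
  funext i
  simp [age, shift]

theorem shiftInvariant_freshOn (A : Finset (Fin n)) (hA : A.Nonempty) (m : Fin M) :
    ShiftInvariant (freshOn A hA m) := by
  intro z s
  simp only [freshOn, Config.setAge, Config.age_shift]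
  rfl

theorem accuracyOn_mem_Icc (A : Finset (Fin n)) (m : Fin M) (z : Config M n) :
    accuracyOn A m z ∈ Set.Icc (0 : ℝ) 1 := by
  have h0 : 0 ≤ z.accuracy A :=
    div_nonneg (Finset.sum_nonneg fun i _ => by split_ifs <;> simp) (Nat.cast_nonneg _)
  have h1 : z.accuracy A ≤ 1 := by
    refine div_le_one_of_le₀ ?_ (Nat.cast_nonneg _)
    calc (∑ i ∈ A, if z.S i = z.Q then (1 : ℝ) else 0) ≤ ∑ i ∈ A, (1 : ℝ) :=
          Finset.sum_le_sum fun i _ => by split_ifs <;> simp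
      _ = A.card := by simp
  simp only [accuracyOn]
  split_ifs
  · exact ⟨h0, h1⟩
  · simp

theorem freshOn_mem_Icc (A : Finset (Fin n)) (hA : A.Nonempty) (m : Fin M) (z : Config M n) :
    freshOn A hA m z ∈ Set.Icc (0 : ℝ) 1 := by
  simp only [freshOn]
  split_ifs <;> simp

theorem accuracyOn_map (A : Finset (Fin n)) (σ : Equiv.Perm (Fin n)) (m : Fin M) :
    accuracyOn (A.map σ.toEmbedding) m = fun z => accuracyOn A m (z.relabel σ) := by
  funext z
  rw [accuracyOn, accuracyOn, Config.accuracy_relabel]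
  rfl

theorem freshOn_map (A : Finset (Fin n)) (hA : A.Nonempty) (σ : Equiv.Perm (Fin n)) (m : Fin M) :
    freshOn (A.map σ.toEmbedding) hA.map m = fun z => freshOn A hA m (z.relabel σ) := by
  funext z
  rw [freshOn, freshOn, Config.setAge_relabel]
  rfl

theorem probFresh_eq_integral {q : Matrix (Fin M) (Fin M) ℝ} {lamS lam : ℝ} (z : Config M n)
    (A : Finset (Fin n)) (hA : A.Nonempty) (m : Fin M) (t : ℝ) :
    probFresh q lamS lam z A hA m t =
      ∫ ω, freshOn A hA m (process z t ω) ∂(clockLaw n q lamS lam) := by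
  have hset : {ω : Sample M n | (process z t ω).Q = m ∧ (process z t ω).setAge A hA = 0} =
      (fun ω => freshOn A hA m (process z t ω)) ⁻¹' {1} := by
    ext ω
    by_cases h : (process z t ω).Q = m ∧ (process z t ω).setAge A hA = 0 <;> simp [freshOn, h]
  have hm : MeasurableSet
      {ω : Sample M n | (process z t ω).Q = m ∧ (process z t ω).setAge A hA = 0} := by
    rw [hset]
    exact measurable_process z (freshOn A hA m) t (MeasurableSet.singleton 1)
  rw [probFresh, ← integral_indicator_one hm]
  refine integral_congr_ae (ae_of_all _ fun ω => ?_)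
  simp [Set.indicator_apply, freshOn]

end Observables

/-! ### The stationary source and the freshness equation -/

section NoGossip

variable {M n : ℕ}

theorem sum_event (F : Event M n → ℝ) :
    ∑ e, F e = ∑ i, ∑ j, F (.source i j) + ∑ j, F (.push j) + ∑ i, ∑ j, F (.gossip i j) := by
  let φ : (Fin M × Fin M) ⊕ Fin n ⊕ (Fin n × Fin n) ≃ Event M n :=
    { toFun := Sum.elim (fun x => .source x.1 x.2) (Sum.elim .push fun x => .gossip x.1 x.2)
      invFun := fun e => match e with
        | .source i j => .inl (i, j)
        | .push j => .inr (.inl j)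
        | .gossip i j => .inr (.inr (i, j))
      left_inv := by rintro (x | x | x) <;> rfl
      right_inv := by rintro (x | x | x) <;> rfl }
  rw [← φ.sum_comp, Fintype.sum_sum_type, Fintype.sum_sum_type, Fintype.sum_prod_type,
    Fintype.sum_prod_type, ← add_assoc]
  rfl

/-- The step of the jump chain through the generator of the network. -/
theorem step_weight_eq {q : Matrix (Fin M) (Fin M) ℝ} (hq : IsIrreducibleGenerator q)
    {lamS lam : ℝ} (hlamS : 0 < lamS) (hlam : 0 ≤ lam) (hn : 1 ≤ n) (f : Config M n → ℝ)
    (z : Config M n) :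
    step (weight q lamS lam) f z = f z + (totalRate n q lamS lam)⁻¹ *
      ∑ e : Event M n, rate q lamS lam e * (f (z.next e) - f z) := by
  have h1 := sum_weight (n := n) hq hlamS hlam hn
  calc step (weight q lamS lam) f z
      = ∑ e : Event M n, (weight q lamS lam e * f z +
          weight q lamS lam e * (f (z.next e) - f z)) :=
        Finset.sum_congr rfl fun e _ => by ring
    _ = _ := by
        rw [Finset.sum_add_distrib, ← Finset.sum_mul, h1, one_mul, Finset.mul_sum]
        congr 1
        exact Finset.sum_congr rfl fun e _ => by rw [weight]; ring

theorem sum_rate_source (q : Matrix (Fin M) (Fin M) ℝ) (lamS lam : ℝ) (f : Config M n → ℝ)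
    (z : Config M n) :
    ∑ i, ∑ j, rate q lamS lam (Event.source (n := n) i j) * (f (z.next (.source i j)) - f z) =
      ∑ j ∈ Finset.univ.erase z.Q,
        q z.Q j * (f { z with Q := j, V₀ := z.V₀ + 1 } - f z) := by
  rw [Finset.sum_eq_single z.Q]
  · rw [← Finset.sum_erase (s := Finset.univ) (a := z.Q)]
    · refine Finset.sum_congr rfl fun j hj => ?_
      simp [rate, Config.next, (Finset.ne_of_mem_erase hj).symm]
    · simp [rate]
  · intro i _ hi
    exact Finset.sum_eq_zero fun j _ => by simp [Config.next, hi.symm]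
  · simp

/-- On functions of the source state one step acts as `1 + Λ⁻¹ q`, with `Λ` the total rate, and the
balance equations say that `p` annihilates `q`. -/
theorem sum_sync_iterate_step {q : Matrix (Fin M) (Fin M) ℝ} (hq : IsIrreducibleGenerator q)
    {p : Fin M → ℝ} (hp : IsStationaryDistribution q p) {lamS lam : ℝ} (hlamS : 0 < lamS)
    (hlam : 0 ≤ lam) (hn : 1 ≤ n) (u : Fin M → ℝ) (N : ℕ) :
    ∑ i, p i * (step (weight q lamS lam))^[N] (fun z : Config M n => u z.Q) (Config.sync n i) =
      ∑ i, p i * u i := by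
  induction N generalizing u with
  | zero => rfl
  | succ N ih =>
    obtain ⟨u', hu'⟩ : ∃ u' : Fin M → ℝ,
      ∀ i, u' i = u i + (totalRate n q lamS lam)⁻¹ * ∑ j, q i j * u j := ⟨_, fun _ => rfl⟩
    have hstep : step (weight q lamS lam) (fun z : Config M n => u z.Q) = fun z => u' z.Q := by
      funext z
      rw [step_weight_eq hq hlamS hlam hn, sum_event, hu',
        sum_rate_source q lamS lam (fun z => u z.Q)]
      have h1 : ∀ j, u (z.next (.push j)).Q = u z.Q := fun j => rfl
      have h2 : ∀ i j, u (z.next (.gossip i j)).Q = u z.Q := fun i j => by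
        simp only [Config.next]; split_ifs <;> rfl
      simp only [h1, h2, sub_self, mul_zero, Finset.sum_const_zero, add_zero]
      congr 2
      rw [Finset.sum_erase _ (by simp)]
      simp only [mul_sub, Finset.sum_sub_distrib, ← Finset.sum_mul, hq.row_sum, zero_mul, sub_zero]
    rw [Function.iterate_succ_apply, hstep, ih]
    simp only [hu', mul_add, Finset.sum_add_distrib]
    have h3 : ∑ i, p i * ((totalRate n q lamS lam)⁻¹ * ∑ j, q i j * u j) = 0 := by
      calc ∑ i, p i * ((totalRate n q lamS lam)⁻¹ * ∑ j, q i j * u j)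
          = ∑ i, ∑ j, (totalRate n q lamS lam)⁻¹ * (p i * q i j * u j) := by
            refine Finset.sum_congr rfl fun i _ => ?_
            rw [Finset.mul_sum, Finset.mul_sum]
            exact Finset.sum_congr rfl fun j _ => by ring
        _ = ∑ j, (totalRate n q lamS lam)⁻¹ * ((∑ i, p i * q i j) * u j) := by
            rw [Finset.sum_comm]
            exact Finset.sum_congr rfl fun j _ => by rw [← Finset.mul_sum, Finset.sum_mul]
        _ = 0 := by simp [hp.balance]
    rw [h3, add_zero]

/-- In the long run the source is in state `m` with probability `p m`. -/
theorem tendsto_iterate_step_source {q : Matrix (Fin M) (Fin M) ℝ}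
    (hq : IsIrreducibleGenerator q) {p : Fin M → ℝ} (hp : IsStationaryDistribution q p)
    {lamS lam : ℝ} (hlamS : 0 < lamS) (hlam : 0 ≤ lam) (hn : 1 ≤ n) (m : Fin M)
    (z : Config M n) :
    Tendsto (fun N => (step (weight q lamS lam))^[N]
      (fun z : Config M n => if z.Q = m then (1 : ℝ) else 0) z) atTop (𝓝 (p m)) := by
  obtain ⟨c, hc, -⟩ := exists_longRun hq hlamS hn m
    (f := fun z : Config M n => if z.Q = m then (1 : ℝ) else 0) (fun _ _ => rfl)
    (fun z => by split_ifs <;> simp)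
  -- Averaged over starts drawn from `p` the expectation is constantly `p m`, while the limit is the
  -- same for every start.
  have h1 : Tendsto (fun N => ∑ i, p i * (step (weight q lamS lam))^[N]
      (fun z : Config M n => if z.Q = m then (1 : ℝ) else 0) (Config.sync n i)) atTop
      (𝓝 (∑ i, p i * c lam)) :=
    tendsto_finsetSum _ fun i _ => (hc lam hlam _).const_mul _
  simp only [sum_sync_iterate_step hq hp hlamS hlam hn (fun i => if i = m then (1 : ℝ) else 0)]
    at h1
  have h2 := tendsto_nhds_unique h1 tendsto_const_nhds
  rw [← Finset.sum_mul, hp.sum_eq_one, one_mul] at h2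
  have h3 : c lam = p m := by simpa using h2
  exact h3 ▸ hc lam hlam z

/-- No node holds a version newer than that of the source. -/
def Config.IsValid (z : Config M n) : Prop := ∀ i, z.V i ≤ z.V₀

theorem Config.IsValid.next {z : Config M n} (hz : z.IsValid) (e : Event M n) :
    (z.next e).IsValid := by
  cases e with
  | source i j =>
    by_cases h : z.Q = i
    · intro r
      simpa [Config.next, h] using (hz r).trans z.V₀.le_succ
    · simpa [Config.next, h] using hz
  | push j =>
    intro r
    by_cases h : r = j
    · simp [Config.next, h]
    · simpa [Config.next, h] using hz r
  | gossip i j =>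
    by_cases hv : z.V j < z.V i
    · intro r
      by_cases h : r = j
      · simpa [Config.next, h, hv] using hz i
      · simpa [Config.next, h, hv] using hz r
    · simpa [Config.next, hv] using hz

/-- Validity makes all ages nonnegative, so the minimum vanishes exactly when some age does. -/
theorem Config.IsValid.setAge_eq_zero_iff {z : Config M n} (hz : z.IsValid) {A : Finset (Fin n)}
    (hA : A.Nonempty) : z.setAge A hA = 0 ↔ ∃ i ∈ A, z.V i = z.V₀ := by
  have hage : ∀ i, 0 ≤ z.age i := fun i => by
    have := hz i
    simp only [age]
    omega
  constructor
  · intro h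
    obtain ⟨i, hi, h1⟩ := Finset.exists_mem_eq_inf' hA z.age
    refine ⟨i, hi, ?_⟩
    have h2 : z.age i = 0 := h1.symm.trans h
    simp only [age] at h2
    omega
  · rintro ⟨i, hi, h⟩
    refine le_antisymm ?_ (Finset.le_inf' _ _ fun j _ => hage j)
    refine (Finset.inf'_le z.age hi).trans ?_
    simp [age, h]

/-- The generator without gossip, on the indicator of `Q = m, X_A = 0`. -/
theorem step_freshOn {q : Matrix (Fin M) (Fin M) ℝ} (hq : IsIrreducibleGenerator q)
    {lamS : ℝ} (hlamS : 0 < lamS) (hn : 1 ≤ n) {A : Finset (Fin n)} (hA : A.Nonempty)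
    (m : Fin M) {z : Config M n} (hz : z.IsValid) :
    step (weight q lamS 0) (freshOn A hA m) z =
      (1 - (totalRate n q lamS 0)⁻¹ * (exitRate q m + pushRate n lamS A.card)) *
          freshOn A hA m z +
        (totalRate n q lamS 0)⁻¹ * pushRate n lamS A.card * if z.Q = m then 1 else 0 := by
  have hfresh : ∀ y : Config M n, y.IsValid →
      freshOn A hA m y = if y.Q = m ∧ ∃ i ∈ A, y.V i = y.V₀ then 1 else 0 := fun y hy => by
    simp only [freshOn, hy.setAge_eq_zero_iff hA]
  have hsource : ∑ j ∈ Finset.univ.erase z.Q, q z.Q j *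
      (freshOn A hA m { z with Q := j, V₀ := z.V₀ + 1 } - freshOn A hA m z) =
      -(exitRate q m * freshOn A hA m z) := by
    -- After a transition the source version exceeds every version held by a node.
    have h0 : ∀ j, freshOn A hA m { z with Q := j, V₀ := z.V₀ + 1 } = 0 := by
      intro j
      have hv : Config.IsValid { z with Q := j, V₀ := z.V₀ + 1 } :=
        fun i => (hz i).trans z.V₀.le_succ
      rw [hfresh _ hv, if_neg]
      rintro ⟨-, i, -, h⟩
      have h1 := hz i
      simp only at h
      omega
    simp only [h0, zero_sub, mul_neg, Finset.sum_neg_distrib, ← Finset.sum_mul]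
    by_cases hQ : z.Q = m
    · rw [hQ, exitRate]
    · simp [freshOn, hQ]
  have hpush : ∑ j, rate q lamS 0 (Event.push j) *
      (freshOn A hA m (z.next (.push j)) - freshOn A hA m z) =
      pushRate n lamS A.card * ((if z.Q = m then 1 else 0) - freshOn A hA m z) := by
    -- A push into `A` makes `A` fresh; a push elsewhere leaves `A` untouched.
    have h1 : ∀ j, freshOn A hA m (z.next (.push j)) - freshOn A hA m z =
        if j ∈ A then (if z.Q = m then 1 else 0) - freshOn A hA m z else 0 := by
      intro j
      rw [hfresh _ (hz.next _)]
      have hQ' : (z.next (.push j)).Q = z.Q := rfl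
      have hV' : (z.next (.push j)).V₀ = z.V₀ := rfl
      rw [hQ', hV']
      split_ifs with h2 h3 hQ h3 hQ
      · rfl
      · exact absurd h2.1 hQ
      · obtain ⟨hQ, i, hi, h⟩ := h2
        have hij : i ≠ j := fun h => h3 (h ▸ hi)
        rw [hfresh z hz, if_pos ⟨hQ, i, hi, by simpa [Config.next, hij] using h⟩, sub_self]
      · exact absurd ⟨hQ, j, h3, by simp [Config.next]⟩ h2
      · rfl
      · rw [hfresh z hz, if_neg, sub_self]
        rintro ⟨hQ, i, hi, h⟩
        have hij : i ≠ j := fun h => h3 (h ▸ hi)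
        exact h2 ⟨hQ, i, hi, by simpa [Config.next, hij] using h⟩
    simp only [h1, rate, mul_ite, mul_zero, Finset.sum_ite_mem, Finset.univ_inter,
      Finset.sum_const, nsmul_eq_mul, pushRate]
    ring
  have hgossip : ∑ i, ∑ j, rate q lamS 0 (Event.gossip i j) *
      (freshOn A hA m (z.next (.gossip i j)) - freshOn A hA m z) = 0 :=
    Finset.sum_eq_zero fun i _ => Finset.sum_eq_zero fun j _ => by simp [rate]
  rw [step_weight_eq hq hlamS le_rfl hn, sum_event, sum_rate_source, hsource, hpush, hgossip]
  ring

/-- Letting `N → ∞` in the one-step recursion gives a linear equation for `g`, the source term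
converging to `p m`. -/
theorem longRun_freshOn {q : Matrix (Fin M) (Fin M) ℝ} (hq : IsIrreducibleGenerator q)
    {p : Fin M → ℝ} (hp : IsStationaryDistribution q p) {lamS : ℝ} (hlamS : 0 < lamS)
    (hn : 1 ≤ n) {A : Finset (Fin n)} (hA : A.Nonempty) (m : Fin M) {g : ℝ}
    (hg : ∀ z, Tendsto (fun N => (step (weight q lamS 0))^[N] (freshOn A hA m) z) atTop (𝓝 g)) :
    g = pushRate n lamS A.card * p m / (exitRate q m + pushRate n lamS A.card) := by
  set Λ := totalRate n q lamS 0 with hΛ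
  have hΛpos : 0 < Λ := totalRate_pos hq hlamS le_rfl hn
  set α := pushRate n lamS A.card with hα
  have hαpos : 0 < α := by
    have h1 : (0 : ℝ) < n := by exact_mod_cast hn
    have h2 : (0 : ℝ) < A.card := by exact_mod_cast hA.card_pos
    rw [hα, pushRate]
    positivity
  have hν : 0 ≤ exitRate q m :=
    Finset.sum_nonneg fun r hr => hq.nonneg m r (Finset.ne_of_mem_erase hr).symm
  set z := Config.sync n m with hz
  have hvalid : z.IsValid := fun _ => le_rfl
  have hrec : ∀ N, (step (weight q lamS 0))^[N + 1] (freshOn A hA m) z =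
      (1 - Λ⁻¹ * (exitRate q m + α)) * (step (weight q lamS 0))^[N] (freshOn A hA m) z +
      Λ⁻¹ * α * (step (weight q lamS 0))^[N]
        (fun y : Config M n => if y.Q = m then (1 : ℝ) else 0) z := by
    intro N
    have hw1 := sum_weight (n := n) hq hlamS le_rfl hn
    rw [Function.iterate_succ_apply, iterate_step_congr
      (p := Config.IsValid) (fun y e hy => hy.next e)
      (fun y hy => step_freshOn hq hlamS hn hA m hy) N hvalid, iterate_step_add]
    congr 1
    · simpa using iterate_step_affine hw1 _ 0 (freshOn A hA m) N z
    · simpa using iterate_step_affine hw1 (Λ⁻¹ * α) 0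
        (fun y : Config M n => if y.Q = m then (1 : ℝ) else 0) N z
  have h1 := (hg z).comp (tendsto_add_atTop_nat 1)
  have h2 := ((hg z).const_mul (1 - Λ⁻¹ * (exitRate q m + α))).add
    ((tendsto_iterate_step_source hq hp hlamS le_rfl hn m z).const_mul (Λ⁻¹ * α))
  have h3 := tendsto_nhds_unique (h1.congr hrec) h2
  rw [eq_div_iff (by linarith)]
  have h4 : Λ⁻¹ * (g * (exitRate q m + α)) = Λ⁻¹ * (α * p m) := by linarith
  exact mul_left_cancel₀ (inv_ne_zero hΛpos.ne') h4

end NoGossip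

end GossipNetwork

theorem mainTheorem12 {M n : ℕ} (q : Matrix (Fin M) (Fin M) ℝ) (p : Fin M → ℝ)
    (hq : GossipNetwork.IsIrreducibleGenerator q)
    (hp : GossipNetwork.IsStationaryDistribution q p)
    (lamS : ℝ) (hlamS : 0 < lamS) (k : ℕ) (hk : 1 ≤ k) (hkn : k ≤ n) :
    ∃ c g : ℝ → Fin M → ℝ,
      -- `c lam m` and `g lam m` are the long-run values of `E[C_A(t) 1{Q(t) = m}]` and
      -- `P(Q(t) = m, X_A(t) = 0)` for gossip rate `lam`, for every start and every `k`-node set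
      (∀ lam : ℝ, 0 ≤ lam → ∀ (z₀ : GossipNetwork.Config M n) (A : Finset (Fin n))
        (hA : A.Nonempty), A.card = k → ∀ m : Fin M,
          Tendsto (fun t : ℝ => GossipNetwork.expAccuracy q lamS lam z₀ A m t) atTop
            (𝓝 (c lam m)) ∧
          Tendsto (fun t : ℝ => GossipNetwork.probFresh q lamS lam z₀ A hA m t) atTop
            (𝓝 (g lam m))) ∧
      (∀ m : Fin M, Tendsto (fun lam : ℝ => g lam m) (𝓝[>] 0) (𝓝 (g 0 m)) ∧
        g 0 m = GossipNetwork.pushRate n lamS k * p m /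
          (GossipNetwork.exitRate q m + GossipNetwork.pushRate n lamS k)) ∧
      ∃ c₀ : Fin M → ℝ,
        (∀ m : Fin M, Tendsto (fun lam : ℝ => c lam m) (𝓝[>] 0) (𝓝 (c₀ m))) ∧
        Tendsto (fun lam : ℝ => ∑ m : Fin M, c lam m * g lam m) (𝓝[>] 0)
          (𝓝 (∑ m : Fin M, GossipNetwork.pushRate n lamS k * p m /
            (GossipNetwork.exitRate q m + GossipNetwork.pushRate n lamS k) * c₀ m)) := by
  open GossipNetwork in
  have hn : 1 ≤ n := hk.trans hkn
  -- The limits are defined through one reference set `B`; any other `k`-node set is its image under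
  -- a permutation, which merely changes the start.
  obtain ⟨B, -, rfl⟩ := Finset.exists_subset_card_eq (s := (Finset.univ : Finset (Fin n)))
    (n := k) (by simpa using hkn)
  have hB : B.Nonempty := Finset.card_pos.1 hk
  choose c hc hc0 using fun m => exists_longRun hq hlamS hn m
    (shiftInvariant_accuracyOn B m) (accuracyOn_mem_Icc B m)
  choose g hg hg0 using fun m => exists_longRun hq hlamS hn m
    (shiftInvariant_freshOn B hB m) (freshOn_mem_Icc B hB m)
  have hform := fun m => longRun_freshOn hq hp hlamS hn hB m (hg m 0 le_rfl)
  refine ⟨fun lam m => c m lam, fun lam m => g m lam, ?_, fun m => ⟨hg0 m, hform m⟩,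
    fun m => c m 0, hc0, ?_⟩
  · intro lam hlam z₀ A hA hcard m
    obtain ⟨σ, rfl⟩ := exists_perm_map_eq hcard.symm
    constructor
    · refine tendsto_integral_process hq hlamS hlam hn z₀ (accuracyOn_mem_Icc _ m) ?_
      simp only [accuracyOn_map, iterate_step_relabel]
      exact hc m lam hlam _
    · simp only [probFresh_eq_integral]
      refine tendsto_integral_process hq hlamS hlam hn z₀ (freshOn_mem_Icc _ hA m) ?_
      simp only [freshOn_map B hB, iterate_step_relabel]
      exact hg m lam hlam _
  · refine tendsto_finsetSum _ fun m _ => ?_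
    rw [← hform m, mul_comm]
    exact (hc0 m).mul (hg0 m)
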